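/- Let $E$ and $F$ be complex Banach spaces, let $U\subseteq E$ be open, and let $1<p\le\infty$. Let $p^*$ denote the conjugate index of $p$ (so $p^*=p/(p-1)$ if $p<\infty$, and $p^*=1$ if $p=\infty$), and let $B_{F^{**}}$ be the closed unit ball of the bidual $F^{**}$. A holomorphic mapping $f\colon U\to F$ is called Cohen strongly $p$-summing if there is a constant $C\ge 0$ such that for all $n\in\mathbb{N}$, $\lambda_1,\dots,\lambda_n\in\mathbb{C}$, $x_1,\dots,x_n\in U$ and $y_1^*,\dots,y_n^*\in F^*$, $$\sum_{i=1}^n|\lambda_i|\,|\langle y_i^*,f(x_i)\rangle|\le C\left(\sum_{i=1}^n|\lambda_i|^p\right)^{1/p}\sup_{y^{**}\in B_{F^{**}}}\left(\sum_{i=1}^n|y^{**}(y_i^*)|^{p^*}\right)^{1/p^*},$$ where for $p=\infty$ the factor $\left(\sum_{i=1}^n|\lambda_i|^p\right)^{1/p}$ is replaced by $\max_{1\le i\le n}|\lambda_i|$. (1) If $f\colon U\to F$ is a Cohen strongly $p$-summing holomorphic mapping, then its range $f(U)$ is relatively weakly compact in $F$, that is, its closure in the weak topology of $F$ is weakly compact.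 (2) If $F$ is reflexive and $f\colon U\to F$ is a Cohen strongly $p$-summing holomorphic mapping, then $f(U)$ is relatively compact in $F$, that is, its norm closure is compact. -/

import Mathlib

noncomputable section

open scoped ENNReal

/-- The `ℓ_p` norm of a finite family of complex numbers:
`(∑ |a i| ^ p) ^ (1 / p)` for `p < ∞` and `max |a i|` for `p = ∞`. -/
def finLpNorm (p : ℝ≥0∞) {n : ℕ} (a : Fin n → ℂ) : ℝ :=
  if p = ∞ then ⨆ i, ‖a i‖ else (∑ i, ‖a i‖ ^ p.toReal) ^ (1 / p.toReal)

/-- The weak `ℓ_q` norm of a finite family of functionals `y i ∈ F*`, i.e. the supremum, over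
`φ` in the closed unit ball of `F**`, of the `ℓ_q` norm of `(φ (y i))_i`. This is the supremum of
a nonempty set of reals that is bounded above, as `|φ (y i)| ≤ ‖y i‖`. -/
def weakLpNorm (q : ℝ≥0∞) {F : Type*} [NormedAddCommGroup F] [NormedSpace ℂ F]
    {n : ℕ} (y : Fin n → StrongDual ℂ F) : ℝ :=
  ⨆ φ : Metric.closedBall (0 : StrongDual ℂ (StrongDual ℂ F)) 1,
    finLpNorm q (fun i => (φ : StrongDual ℂ (StrongDual ℂ F)) (y i))

/-- `f` is a Cohen strongly `p`-summing holomorphic mapping on the open set `U` (`1 ≤ p ≤ ∞`).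
The conjugate index `ENNReal.conjExponent p` is `p / (p - 1)` for `1 < p < ∞`, is `∞` for `p = 1`
and is `1` for `p = ∞`. -/
structure IsCohenStronglySummingHolomorphic (p : ℝ≥0∞) {E F : Type*}
    [NormedAddCommGroup E] [NormedSpace ℂ E] [NormedAddCommGroup F] [NormedSpace ℂ F]
    (U : Set E) (f : E → F) : Prop where
  holomorphic : DifferentiableOn ℂ f U
  exists_bound : ∃ C : ℝ, 0 ≤ C ∧
    ∀ (n : ℕ) (c : Fin n → ℂ) (x : Fin n → E) (y : Fin n → StrongDual ℂ F),
      (∀ i, x i ∈ U) →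
      ∑ i, ‖c i‖ * ‖y i (f (x i))‖ ≤
        C * finLpNorm p c * weakLpNorm (ENNReal.conjExponent p) y

/-- A complex Banach space is reflexive if the canonical embedding into its bidual is onto. -/
def IsReflexiveSpace (F : Type*) [NormedAddCommGroup F] [NormedSpace ℂ F] : Prop :=
  Function.Surjective (NormedSpace.inclusionInDoubleDual ℂ F)

/-- The norm closure of `s` is norm compact. -/
def IsRelativelyCompact {F : Type*} [NormedAddCommGroup F] (s : Set F) : Prop :=
  IsCompact (closure s)

/-- The closure of `s` in the weak topology is weakly compact. -/
def IsRelativelyWeaklyCompact {F : Type*} [NormedAddCommGroup F] [NormedSpace ℂ F]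
    (s : Set F) : Prop :=
  IsCompact (closure (toWeakSpace ℂ F '' s))

end

section

open scoped ENNReal
open MeasureTheory CompactlySupported Filter Topology

/-! Let `q` be the conjugate exponent of `p` and `A = f '' U`. Weights `|y_i(f x_i)|^(q-1)` turn the
summing inequality into a `q`-summing inequality for the transpose `y ↦ y ∘ f`. Pietsch domination
then gives a probability measure `μ` on the weak* compact ball of `F**` with `|y a|^q ≤ C ∫ |φ y|^q
dμ` for all `a ∈ A`, with `C` the constant of that `q`-summing inequality. So `A` is bounded, and on
bounded sets of functionals, smallness in `L²(μ)` forces uniform smallness on `A`.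

(1) Suppose `Φ ∈ F** \ F` is a weak* limit of `A`. For each finite `S ⊆ F`, Helly's argument gives
uniformly bounded `y` with `Φ y = 1` and `y = 0` on `S`. Near-minimizers of the `L²` norm under
these constraints are close to each other for large `S`, by the parallelogram law. Adding to `S` a
point `a ∈ A` with `u a` near `Φ u = 1` forces the new near-minimizer to vanish at `a`, a
contradiction.

(2) Weakly null sequences in `F*` tend to `0` in `L²(μ)`, hence uniformly on `A`. Under reflexivity,
weakly convergent subsequences in `F` and `F*` then upgrade to norm convergence in `A`. -/

/-! ### Weak compactness from a Hilbertian seminorm -/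

/-- **Helly-type selection.** A functional on `X` outside the range of an isometry `J` from a
Banach space into the dual of `X` is normalized on uniformly bounded vectors that are annihilated
by any given finite subset of the range of `J`. -/
theorem exists_bound_forall_finset_exists_eq_one {F X : Type*} [NormedAddCommGroup F]
    [NormedSpace ℂ F] [CompleteSpace F] [NormedAddCommGroup X] [NormedSpace ℂ X]
    (J : F →ₗᵢ[ℂ] StrongDual ℂ X) {Φ : StrongDual ℂ X} (hΦ : Φ ∉ Set.range J) :
    ∃ R : ℝ, ∀ S : Finset F, ∃ y : X, ‖y‖ ≤ R ∧ Φ y = 1 ∧ ∀ x ∈ S, J x y = 0 := by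
  have hclosed : IsClosed (Set.range J) := J.isometry.isClosedEmbedding.isClosed_range
  have hd : 0 < Metric.infDist Φ (Set.range J) :=
    (hclosed.notMem_iff_infDist_pos ⟨J 0, 0, rfl⟩).1 hΦ
  set d := Metric.infDist Φ (Set.range J) with hd_def
  refine ⟨2 / d, fun S => ?_⟩
  let M : Submodule ℂ X := ⨅ x : S, LinearMap.ker (J x).toLinearMap
  have hM : ∀ y, y ∈ M ↔ ∀ x ∈ S, J x y = 0 := by
    intro y
    simp only [M, Submodule.mem_iInf, LinearMap.mem_ker, Subtype.forall]
    rfl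
  -- A norm-preserving extension `Ψ` of `Φ` restricted to `M` differs from `Φ` by a functional
  -- vanishing on a finite intersection of kernels, hence by some `J x`; so `‖Ψ‖` is the distance
  -- from `Φ` to a point of the range.
  have key : d ≤ ‖Φ.comp M.subtypeL‖ := by
    obtain ⟨Ψ, hΨ, hn⟩ := exists_extension_norm_eq M (Φ.comp M.subtypeL)
    rw [← hn]
    have hker : (⨅ x : S, LinearMap.ker (J x).toLinearMap) ≤
        LinearMap.ker (Φ - Ψ).toLinearMap := by
      intro y hy
      have := hΨ ⟨y, hy⟩
      simp only [LinearMap.mem_ker]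
      simp at this
      simp [this]
    have hmem := mem_span_of_iInf_ker_le_ker hker
    have hspan : Submodule.span ℂ (Set.range fun x : S => (J x).toLinearMap) ≤
        Submodule.map ((ContinuousLinearMap.coeLM ℂ).comp J.toLinearMap) ⊤ := by
      rw [Submodule.span_le]
      rintro _ ⟨x, rfl⟩
      exact ⟨x, trivial, rfl⟩
    obtain ⟨x, -, hx⟩ := hspan hmem
    have hx' : J x = Φ - Ψ := ContinuousLinearMap.coe_injective hx
    calc d ≤ dist Φ (J x) := Metric.infDist_le_dist_of_mem ⟨x, rfl⟩
      _ = ‖Ψ‖ := by rw [hx', dist_eq_norm]; simp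
  obtain ⟨y, hy⟩ : ∃ y : M, d / 2 * ‖y‖ < ‖Φ y‖ := by
    by_contra! h
    have := ContinuousLinearMap.opNorm_le_bound (Φ.comp M.subtypeL) (by positivity) h
    linarith
  have hΦy : 0 < ‖Φ y‖ := lt_of_le_of_lt (by positivity) hy
  refine ⟨(Φ y)⁻¹ • (y : X), ?_, ?_, ?_⟩
  · rw [norm_smul, norm_inv, inv_mul_le_iff₀ hΦy]
    have : ‖(y : X)‖ = ‖y‖ := rfl
    rw [this]
    field_simp
    linarith
  · rw [map_smul, smul_eq_mul, inv_mul_cancel₀ (norm_pos_iff.1 hΦy)]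
  · intro x hx
    simp [(hM y).1 y.2 x hx]

/-- A bounded set on which bounded functionals are uniformly small wherever a nonnegative
functional satisfying the parallelogram law is small, is relatively weakly compact. -/
theorem isRelativelyWeaklyCompact_of_parallelogram {F : Type*} [NormedAddCommGroup F]
    [NormedSpace ℂ F] [CompleteSpace F] {A : Set F} (hA : Bornology.IsBounded A)
    (G : StrongDual ℂ F → ℝ) (hG : ∀ y, 0 ≤ G y) (hle : ∀ y, G y ≤ ‖y‖ ^ 2)
    (hpar : ∀ u v, G (u + v) + G (u - v) = 2 * G u + 2 * G v)
    (hsmall : ∀ R ε : ℝ, 0 < ε → ∃ δ, 0 < δ ∧ ∀ y : StrongDual ℂ F, ‖y‖ ≤ R → G y ≤ δ →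
      ∀ a ∈ A, ‖y a‖ ≤ ε) :
    IsRelativelyWeaklyCompact A := by
  -- It suffices that every weak* limit of `A` in the bidual comes from `F`.
  refine NormedSpace.isCompact_closure_of_isBounded ℂ F _ ?_ ?_
  · rwa [Set.preimage_image_eq _ (toWeakSpace ℂ F).injective]
  intro Φ hΦ
  by_contra hnot
  have hnot' : WeakDual.toStrongDual Φ ∉ Set.range (NormedSpace.inclusionInDoubleDual ℂ F) := by
    rintro ⟨x, hx⟩
    exact hnot ⟨toWeakSpace ℂ F x, congrArg StrongDual.toWeakDual hx⟩
  obtain ⟨R, hR⟩ := exists_bound_forall_finset_exists_eq_one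
    (NormedSpace.inclusionInDoubleDualLi (E := F) ℂ) hnot'
  -- the convex set attached to a finite set
  let D : Finset F → Set (StrongDual ℂ F) :=
    fun S => {y | ‖y‖ ≤ R ∧ Φ y = 1 ∧ ∀ x ∈ S, y x = 0}
  have hDne : ∀ S, (D S).Nonempty := hR
  let d : Finset F → ℝ := fun S => sInf (G '' D S)
  have hbdd : ∀ S, BddBelow (G '' D S) := fun S => ⟨0, by rintro _ ⟨y, -, rfl⟩; exact hG y⟩
  have hd_le : ∀ S, ∀ y ∈ D S, d S ≤ G y := fun S y hy => csInf_le (hbdd S) ⟨y, hy, rfl⟩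
  have hhom : ∀ y, G y = 4 * G ((2⁻¹ : ℂ) • y) := by
    intro y
    have h0 := hpar 0 0
    have h1 := hpar ((2⁻¹ : ℂ) • y) ((2⁻¹ : ℂ) • y)
    rw [show (2⁻¹ : ℂ) • y + (2⁻¹ : ℂ) • y = y by
      ext x; simp; ring, sub_self] at h1
    norm_num at h0
    linarith
  have hmid : ∀ S, ∀ u ∈ D S, ∀ v ∈ D S, (2⁻¹ : ℂ) • (u + v) ∈ D S := by
    rintro S u ⟨hu, hu1, hu2⟩ v ⟨hv, hv1, hv2⟩
    refine ⟨?_, ?_, ?_⟩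
    · rw [norm_smul]
      have := norm_add_le u v
      norm_num
      linarith
    · rw [map_smul, map_add, hu1, hv1]; norm_num
    · intro x hx
      simp [hu2 x hx, hv2 x hx]
  have hnear : ∀ S, ∀ η > 0, ∃ y ∈ D S, G y < d S + η := by
    intro S η hη
    obtain ⟨_, ⟨y, hy, rfl⟩, h⟩ := exists_lt_of_csInf_lt ((hDne S).image G)
      (show sInf (G '' D S) < d S + η by simp only [d]; linarith)
    exact ⟨y, hy, h⟩
  have hdbdd : BddAbove (Set.range d) := by
    refine ⟨R ^ 2, ?_⟩
    rintro _ ⟨S, rfl⟩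
    obtain ⟨y, hy⟩ := hDne S
    exact (hd_le S y hy).trans
      ((hle y).trans (pow_le_pow_left₀ (norm_nonneg y) hy.1 2))
  obtain ⟨δ, hδ, hsm⟩ := hsmall (R + R) (1 / 4) (by norm_num)
  -- With `d S` within `δ / 8` of the supremum, enlarging `S` can raise the infimum by less than `δ
  -- / 8`.
  obtain ⟨_, ⟨S, rfl⟩, hS⟩ := exists_lt_of_lt_csSup (Set.range_nonempty d)
    (show sSup (Set.range d) - δ / 8 < sSup (Set.range d) by linarith)
  obtain ⟨u, huD, hu⟩ := hnear S (δ / 8) (by linarith)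
  obtain ⟨a, ha, hua⟩ : ∃ a ∈ A, ‖u a - 1‖ < 1 / 4 := by
    have hopen : IsOpen {Ψ : WeakDual ℂ (StrongDual ℂ F) | ‖Ψ u - 1‖ < 1 / 4} :=
      isOpen_lt ((WeakDual.eval_continuous u).sub continuous_const).norm continuous_const
    have hmem : Φ ∈ {Ψ : WeakDual ℂ (StrongDual ℂ F) | ‖Ψ u - 1‖ < 1 / 4} := by
      simp [huD.2.1]
    obtain ⟨_, h, _, ⟨a, ha, rfl⟩, rfl⟩ := mem_closure_iff.1 hΦ _ hopen hmem
    exact ⟨a, ha, h⟩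
  classical
  obtain ⟨v, hvD, hv⟩ := hnear (insert a S) (δ / 8) (by linarith)
  have hvS : v ∈ D S := ⟨hvD.1, hvD.2.1, fun x hx => hvD.2.2 x (Finset.mem_insert_of_mem hx)⟩
  have hva : v a = 0 := hvD.2.2 a (Finset.mem_insert_self a S)
  -- The midpoint lies in `D S`, so `G (u + v) ≥ 4 * d S`, and the parallelogram law leaves `G (u -
  -- v) ≤ 2 * (sSup (Set.range d) - d S) + δ / 2 < δ`.
  have h1 := hd_le S _ (hmid S u huD v hvS)
  have h2 := hhom (u + v)
  have h3 := hpar u v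
  have h4 : d (insert a S) ≤ sSup (Set.range d) := le_csSup hdbdd ⟨_, rfl⟩
  have h5 : d S ≤ sSup (Set.range d) := le_csSup hdbdd ⟨_, rfl⟩
  have h6 : G (u - v) ≤ δ := by linarith
  have h7 := hsm (u - v) ((norm_sub_le u v).trans (add_le_add huD.1 hvD.1)) h6 a ha
  rw [sub_apply, hva, sub_zero] at h7
  have h8 : (1 : ℝ) ≤ ‖u a‖ + ‖u a - 1‖ := by
    calc (1 : ℝ) = ‖u a - (u a - 1)‖ := by simp
      _ ≤ _ := norm_sub_le _ _
  linarith

/-! ### Pietsch domination -/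

/-- Separation form of Pietsch domination: if every convex combination of members of a cone-like
set of continuous functions takes a nonpositive value, then some probability measure gives every
member of the set a nonpositive integral. -/
theorem exists_isProbabilityMeasure_forall_integral_nonpos {K : Type*} [TopologicalSpace K]
    [CompactSpace K] [T2Space K] [MeasurableSpace K] [BorelSpace K] {S : Set C(K, ℝ)}
    (hne : S.Nonempty) (hcone : ∀ g ∈ S, ∀ t : ℝ, 0 ≤ t → t • g ∈ S)
    (hS : ∀ g ∈ convexHull ℝ S, ∃ k, g k ≤ 0) :
    ∃ μ : Measure K, IsProbabilityMeasure μ ∧ ∀ g ∈ S, ∫ k, g k ∂μ ≤ 0 := by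
  let P : Set C(K, ℝ) := {g | ∀ k, 0 < g k}
  have hPo : IsOpen P := by
    have : P = {g : C(K, ℝ) | Set.MapsTo g Set.univ (Set.Ioi 0)} := by
      ext g; simp [P, Set.MapsTo]
    rw [this]
    exact ContinuousMap.isOpen_setOfPred_mapsTo isCompact_univ isOpen_Ioi
  have hPc : Convex ℝ P := by
    intro f hf g hg a b ha hb hab k
    simp only [ContinuousMap.add_apply, ContinuousMap.smul_apply, smul_eq_mul]
    rcases ha.eq_or_lt with rfl | ha'
    · obtain rfl : b = 1 := by linarith
      simpa using hg k
    · exact add_pos_of_pos_of_nonneg (mul_pos ha' (hf k)) (mul_nonneg hb (hg k).le)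
  have hdisj : Disjoint P (convexHull ℝ S) := by
    rw [Set.disjoint_left]
    intro g hg hg'
    obtain ⟨k, hk⟩ := hS g hg'
    exact absurd (hg k) (not_lt.2 hk)
  obtain ⟨f, u, hfP, hfS⟩ := geometric_hahn_banach_open hPc hPo (convex_convexHull ℝ S) hdisj
  have hu0 : u ≤ 0 := by
    obtain ⟨g, hg⟩ := hne
    have := hfS _ (subset_convexHull ℝ S (hcone g hg 0 le_rfl))
    simpa using this
  have hfS0 : ∀ g ∈ S, 0 ≤ f g := by
    intro g hg
    by_contra! hneg
    -- This multiple of `g` has `f`-value `u - 1`, below the bound `u`.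
    have := hfS _ (subset_convexHull ℝ S (hcone g hg ((u - 1) / f g)
      (div_nonneg_of_nonpos (by linarith) hneg.le)))
    rw [map_smul, smul_eq_mul, div_mul_cancel₀ _ hneg.ne] at this
    linarith
  have hf1 : f 1 < 0 := lt_of_lt_of_le (hfP 1 fun k => by simp) hu0
  have hfpos : ∀ g : C(K, ℝ), (∀ k, 0 ≤ g k) → f g ≤ 0 := by
    intro g hg
    refine le_of_forall_pos_lt_add fun ε hε => ?_
    have := hfP (g + (ε / -f 1) • 1) fun k => by
      simpa using add_pos_of_nonneg_of_pos (hg k) (div_pos hε (by linarith))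
    rw [map_add, map_smul, smul_eq_mul, div_mul_eq_mul_div, mul_div_assoc, div_neg,
      div_self hf1.ne] at this
    linarith
  let T : C_c(K, ℝ) →ₗ[ℝ] C(K, ℝ) :=
    { toFun := fun g => g.toContinuousMap
      map_add' := fun _ _ => rfl
      map_smul' := fun _ _ => rfl }
  let Λ : C_c(K, ℝ) →ₚ[ℝ] ℝ := PositiveLinearMap.mk₀ ((f 1)⁻¹ • f.toLinearMap.comp T)
    fun g hg => mul_nonneg_of_nonpos_of_nonpos (inv_nonpos.2 hf1.le) (hfpos _ hg)
  have hint : ∀ g : C(K, ℝ), ∫ k, g k ∂(RealRMK.rieszMeasure Λ) = (f 1)⁻¹ * f g := fun g =>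
    RealRMK.integral_rieszMeasure Λ ⟨g, HasCompactSupport.of_compactSpace g⟩
  refine ⟨RealRMK.rieszMeasure Λ, ⟨?_⟩, ?_⟩
  · have h1 := hint 1
    rw [inv_mul_cancel₀ hf1.ne] at h1
    simp only [ContinuousMap.one_apply, integral_const, smul_eq_mul, mul_one] at h1
    rwa [measureReal_def, ENNReal.toReal_eq_one_iff] at h1
  · intro g hg
    rw [hint]
    exact mul_nonpos_of_nonpos_of_nonneg (inv_nonpos.2 hf1.le) (hfS0 g hg)

/-- **Pietsch domination** for a set `A` whose evaluations form a `q`-summing family on the dual: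
the evaluations are dominated by the `L^q` seminorm of a probability measure on the weak* compact
unit ball of the bidual. -/
theorem exists_pietsch_measure {F : Type*} [NormedAddCommGroup F] [NormedSpace ℂ F] {A : Set F}
    {q C : ℝ} (hq : 1 ≤ q) (hne : A.Nonempty)
    {K : Set (WeakDual ℂ (StrongDual ℂ F))} [CompactSpace K] [MeasurableSpace K] [BorelSpace K]
    (hsum : ∀ (n : ℕ) (y : Fin n → StrongDual ℂ F) (a : Fin n → F), (∀ i, a i ∈ A) →
      ∃ φ ∈ K, ∑ i, ‖y i (a i)‖ ^ q ≤ C * ∑ i, ‖φ (y i)‖ ^ q) :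
    ∃ μ : Measure K, IsProbabilityMeasure μ ∧ ∀ a ∈ A, ∀ y : StrongDual ℂ F,
      ‖y a‖ ^ q ≤ C * ∫ φ : K, ‖(φ : WeakDual ℂ (StrongDual ℂ F)) y‖ ^ q ∂μ := by
  have hcont : ∀ y : StrongDual ℂ F,
      Continuous fun φ : K => ‖(φ : WeakDual ℂ (StrongDual ℂ F)) y‖ ^ q := fun y =>
    ((WeakDual.eval_continuous y).comp continuous_subtype_val).norm.rpow_const
      fun _ => Or.inr (by linarith)
  let g : StrongDual ℂ F → F → C(K, ℝ) := fun y a =>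
    ⟨fun φ => ‖y a‖ ^ q - C * ‖(φ : WeakDual ℂ (StrongDual ℂ F)) y‖ ^ q,
      continuous_const.sub (continuous_const.mul (hcont y))⟩
  have hg : ∀ y a (φ : K), g y a φ =
    ‖y a‖ ^ q - C * ‖(φ : WeakDual ℂ (StrongDual ℂ F)) y‖ ^ q := fun _ _ _ => rfl
  -- Since `g` is `q`-homogeneous in `y`, convex weights are absorbed into the functionals and
  -- `hsum` needs no weights.
  have hscale : ∀ y a (t : ℝ), 0 ≤ t → t • g y a = g (((t ^ q⁻¹ : ℝ) : ℂ) • y) a := by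
    intro y a t ht
    have h0 : 0 ≤ t ^ q⁻¹ := Real.rpow_nonneg ht _
    have h1 : (t ^ q⁻¹) ^ q = t := Real.rpow_inv_rpow ht (by linarith)
    ext φ
    rw [ContinuousMap.smul_apply, hg, hg, map_smul, smul_apply, norm_smul, norm_smul,
      Complex.norm_real, Real.norm_of_nonneg h0, Real.mul_rpow h0 (norm_nonneg _),
      Real.mul_rpow h0 (norm_nonneg _), h1, smul_eq_mul]
    ring
  let S : Set C(K, ℝ) := {h | ∃ y, ∃ a ∈ A, h = g y a}
  have hSne : S.Nonempty := by
    obtain ⟨a, ha⟩ := hne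
    exact ⟨g 0 a, 0, a, ha, rfl⟩
  have hScone : ∀ h ∈ S, ∀ t : ℝ, 0 ≤ t → t • h ∈ S := by
    rintro _ ⟨y, a, ha, rfl⟩ t ht
    exact ⟨_, a, ha, hscale y a t ht⟩
  have hShull : ∀ h ∈ convexHull ℝ S, ∃ k, h k ≤ 0 := by
    intro h hh
    obtain ⟨ι, _, w, z, hw, -, hz, rfl⟩ := mem_convexHull_iff_exists_fintype.1 hh
    choose y a ha hz using hz
    let e := (Fintype.equivFin ι).symm
    obtain ⟨φ, hφ, hle⟩ := hsum (Fintype.card ι)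
      (fun i => (((w (e i)) ^ q⁻¹ : ℝ) : ℂ) • y (e i)) (fun i => a (e i)) fun i => ha _
    refine ⟨⟨φ, hφ⟩, ?_⟩
    have : ∑ i, w i • z i = ∑ i, g ((((w (e i)) ^ q⁻¹ : ℝ) : ℂ) • y (e i)) (a (e i)) := by
      rw [← e.sum_comp]
      exact Finset.sum_congr rfl fun i _ => by rw [hz, hscale _ _ _ (hw _)]
    rw [this, ContinuousMap.sum_apply]
    simp only [hg]
    rw [Finset.sum_sub_distrib, ← Finset.mul_sum]
    linarith
  obtain ⟨μ, hμ, h⟩ :=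
    exists_isProbabilityMeasure_forall_integral_nonpos hSne hScone hShull
  refine ⟨μ, hμ, fun a ha y => ?_⟩
  have h1 := h _ ⟨y, a, ha, rfl⟩
  simp only [hg] at h1
  rw [integral_sub (integrable_const _)
    ((hcont y).integrable_of_hasCompactSupport (HasCompactSupport.of_compactSpace _)
      |>.const_mul C), integral_const_mul] at h1
  simpa using h1

/-- Taking `c i = ‖y i (f (x i))‖ ^ (q - 1)` in the defining inequality of Cohen strongly
`p`-summing maps yields the `q`-summing inequality for the transposed map, `q` the conjugate
exponent of `p`. -/
theorem IsCohenStronglySummingHolomorphic.exists_sum_rpow_le {p : ℝ≥0∞} (hp : 1 < p)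
    {E F : Type*} [NormedAddCommGroup E] [NormedSpace ℂ E] [NormedAddCommGroup F]
    [NormedSpace ℂ F] {U : Set E} {f : E → F} (hf : IsCohenStronglySummingHolomorphic p U f) :
    ∃ C : ℝ, 0 ≤ C ∧ ∃ q : ℝ, 1 ≤ q ∧ ∀ (n : ℕ) (x : Fin n → E) (y : Fin n → StrongDual ℂ F),
      (∀ i, x i ∈ U) → ∀ t : ℝ,
      (∀ φ : StrongDual ℂ (StrongDual ℂ F), ‖φ‖ ≤ 1 → C * ∑ i, ‖φ (y i)‖ ^ q ≤ t) →
      ∑ i, ‖y i (f (x i))‖ ^ q ≤ t := by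
  obtain ⟨C, hC, hb⟩ := hf.exists_bound
  set q := (ENNReal.conjExponent p).toReal with hq
  have hq_top : ENNReal.conjExponent p ≠ ∞ := by
    simpa [ENNReal.conjExponent, tsub_eq_zero_iff_le] using hp
  have hq1 : 1 ≤ q := by
    rw [hq, ← ENNReal.toReal_one]
    exact ENNReal.toReal_mono hq_top (by simp [ENNReal.conjExponent])
  have hq0 : 0 < q := by linarith
  refine ⟨C ^ q, by positivity, q, hq1, fun n x y hx t ht => ?_⟩
  set s := ∑ i, ‖y i (f (x i))‖ ^ q with hs
  have hs0 : 0 ≤ s := by positivity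
  have ht0 : 0 ≤ t := le_trans (by positivity) (ht 0 (ContinuousLinearMap.opNorm_zero.trans_le zero_le_one))
  have hw : C * weakLpNorm (ENNReal.conjExponent p) y ≤ t ^ q⁻¹ := by
    rw [weakLpNorm, Real.mul_iSup_of_nonneg hC]
    refine Real.iSup_le (fun φ => ?_) (by positivity)
    rw [finLpNorm, if_neg hq_top, ← hq, one_div]
    rw [Real.le_rpow_inv_iff_of_pos (by positivity) ht0 hq0, Real.mul_rpow hC (by positivity),
      Real.rpow_inv_rpow (by positivity) hq0.ne']
    exact ht φ ((mem_closedBall_zero_iff (E := StrongDual ℂ (StrongDual ℂ F))).1 φ.2)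
  rcases hs0.eq_or_lt with h0 | hs0
  · rw [← h0]; exact ht0
  have hbc := hb n (fun i => ((‖y i (f (x i))‖ ^ (q - 1) : ℝ) : ℂ)) x y hx
  have hfin : finLpNorm p (fun i => ((‖y i (f (x i))‖ ^ (q - 1) : ℝ) : ℂ)) ≤ s ^ (1 - q⁻¹) := by
    have hn : ∀ i, ‖((‖y i (f (x i))‖ ^ (q - 1) : ℝ) : ℂ)‖ = ‖y i (f (x i))‖ ^ (q - 1) := by
      intro i
      rw [Complex.norm_real, Real.norm_of_nonneg (by positivity)]
    rw [finLpNorm]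
    simp only [hn]
    split_ifs with hp'
    -- All weights are `‖·‖ ^ 0 = 1`, also at zero values, and the bound is `s ^ 0 = 1`.
    · have : q = 1 := by rw [hq, hp']; simp [ENNReal.conjExponent]
      rw [this]
      refine Real.iSup_le (fun i => ?_) (by positivity)
      simp
    · have hpq : p.toReal.HolderConjugate q := by
        have := ENNReal.HolderConjugate.conjExponent hp.le
        exact ENNReal.HolderConjugate.toReal_of_ne_top hp' hq_top
      have h1 : (q - 1) * p.toReal = q := hpq.symm.sub_one_mul_conj
      have h2 : ∀ i, (‖y i (f (x i))‖ ^ (q - 1)) ^ p.toReal = ‖y i (f (x i))‖ ^ q := by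
        intro i
        rw [← Real.rpow_mul (norm_nonneg _), h1]
      simp only [h2]
      rw [← hs, one_div, ← hpq.symm.one_sub_inv]
  have hsum : ∑ i, ‖((‖y i (f (x i))‖ ^ (q - 1) : ℝ) : ℂ)‖ * ‖y i (f (x i))‖ = s := by
    refine Finset.sum_congr rfl fun i _ => ?_
    rw [Complex.norm_real, Real.norm_of_nonneg (by positivity)]
    nth_rewrite 2 [← Real.rpow_one ‖y i (f (x i))‖]
    rw [← Real.rpow_add_of_nonneg (norm_nonneg _) (by linarith) zero_le_one, sub_add_cancel]
  rw [hsum] at hbc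
  -- Cancelling `s ^ (1 - q⁻¹)`, which is positive, gives `s ≤ t`.
  have h1 : s ≤ s ^ (1 - q⁻¹) * t ^ q⁻¹ := by
    calc s ≤ _ := hbc
      _ = finLpNorm p (fun i => ((‖y i (f (x i))‖ ^ (q - 1) : ℝ) : ℂ)) *
          (C * weakLpNorm (ENNReal.conjExponent p) y) := by ring
      _ ≤ _ := by
        refine mul_le_mul hfin hw ?_ (by positivity)
        refine mul_nonneg hC (Real.iSup_nonneg fun φ => ?_)
        rw [finLpNorm, if_neg hq_top]
        positivity
  have h2 : s ^ (1 - q⁻¹) * s ^ q⁻¹ = s := by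
    rw [← Real.rpow_add hs0, sub_add_cancel, Real.rpow_one]
  rw [← h2] at h1
  have h3 : s ^ q⁻¹ ≤ t ^ q⁻¹ := by
    rw [h2] at h1
    refine le_of_mul_le_mul_left ?_ (Real.rpow_pos_of_pos hs0 (1 - q⁻¹))
    rwa [h2]
  exact (Real.rpow_le_rpow_iff hs0.le ht0 (inv_pos.2 hq0)).1 h3

/-! ### The `L²` seminorm on the weak* bidual ball -/

/-- The closed unit ball of the bidual of `F`, in its weak* topology. -/
abbrev weakStarBidualBall (F : Type*) [NormedAddCommGroup F] [NormedSpace ℂ F] :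
    Set (WeakDual ℂ (StrongDual ℂ F)) :=
  WeakDual.toStrongDual ⁻¹' Metric.closedBall 0 1

instance (F : Type*) [NormedAddCommGroup F] [NormedSpace ℂ F] :
    CompactSpace (weakStarBidualBall F) :=
  isCompact_iff_compactSpace.1 (WeakDual.isCompact_closedBall 0 1)

noncomputable instance (F : Type*) [NormedAddCommGroup F] [NormedSpace ℂ F] :
    MeasurableSpace (weakStarBidualBall F) := borel _

instance (F : Type*) [NormedAddCommGroup F] [NormedSpace ℂ F] :
    BorelSpace (weakStarBidualBall F) := ⟨rfl⟩

section

variable {F : Type*} [NormedAddCommGroup F] [NormedSpace ℂ F]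

theorem mem_weakStarBidualBall {φ : WeakDual ℂ (StrongDual ℂ F)} :
    φ ∈ weakStarBidualBall F ↔ ‖WeakDual.toStrongDual φ‖ ≤ 1 :=
  mem_closedBall_zero_iff (E := StrongDual ℂ (StrongDual ℂ F))

theorem norm_apply_le_of_mem_weakStarBidualBall (φ : weakStarBidualBall F)
    (y : StrongDual ℂ F) : ‖(φ : WeakDual ℂ (StrongDual ℂ F)) y‖ ≤ ‖y‖ := by
  have h : ‖WeakDual.toStrongDual (φ : WeakDual ℂ (StrongDual ℂ F))‖ ≤ 1 :=
    mem_weakStarBidualBall.1 φ.2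
  simpa using ContinuousLinearMap.le_of_opNorm_le _ h y

theorem continuous_weakStarBidualBall_norm_apply (y : StrongDual ℂ F) :
    Continuous fun φ : weakStarBidualBall F => ‖(φ : WeakDual ℂ (StrongDual ℂ F)) y‖ :=
  ((WeakDual.eval_continuous y).comp continuous_subtype_val).norm

theorem integrable_weakStarBidualBall_norm_apply_rpow (μ : Measure (weakStarBidualBall F))
    [IsFiniteMeasure μ] {q : ℝ} (hq : 0 ≤ q) (y : StrongDual ℂ F) :
    Integrable (fun φ : weakStarBidualBall F => ‖(φ : WeakDual ℂ (StrongDual ℂ F)) y‖ ^ q) μ :=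
  ((continuous_weakStarBidualBall_norm_apply y).rpow_const
    fun _ => Or.inr hq).integrable_of_hasCompactSupport (HasCompactSupport.of_compactSpace _)

/-- The square of the `L²(μ)` norm of the function on the bidual ball induced by `y`. -/
noncomputable def weakStarBidualBall.sqNorm (μ : Measure (weakStarBidualBall F))
    (y : StrongDual ℂ F) : ℝ :=
  ∫ φ : weakStarBidualBall F, ‖(φ : WeakDual ℂ (StrongDual ℂ F)) y‖ ^ 2 ∂μ

namespace weakStarBidualBall

variable (μ : Measure (weakStarBidualBall F))

theorem sqNorm_nonneg (y : StrongDual ℂ F) : 0 ≤ sqNorm μ y :=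
  integral_nonneg fun _ => by positivity

variable [IsProbabilityMeasure μ]

theorem integrable_sq (y : StrongDual ℂ F) :
    Integrable (fun φ : weakStarBidualBall F => ‖(φ : WeakDual ℂ (StrongDual ℂ F)) y‖ ^ 2) μ := by
  simpa using integrable_weakStarBidualBall_norm_apply_rpow μ (q := 2) (by norm_num) y

theorem sqNorm_le (y : StrongDual ℂ F) : sqNorm μ y ≤ ‖y‖ ^ 2 := by
  have := integral_mono (integrable_sq μ y) (integrable_const (‖y‖ ^ 2)) fun φ =>
    pow_le_pow_left₀ (norm_nonneg _) (norm_apply_le_of_mem_weakStarBidualBall φ y) 2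
  simpa [sqNorm] using this

theorem sqNorm_parallelogram (u v : StrongDual ℂ F) :
    sqNorm μ (u + v) + sqNorm μ (u - v) = 2 * sqNorm μ u + 2 * sqNorm μ v := by
  simp only [sqNorm]
  rw [← integral_add (integrable_sq μ _) (integrable_sq μ _), ← integral_const_mul,
    ← integral_const_mul, ← integral_add ((integrable_sq μ u).const_mul 2)
      ((integrable_sq μ v).const_mul 2)]
  refine integral_congr_ae (Eventually.of_forall fun φ => ?_)
  have := parallelogram_law_with_norm ℂ ((φ : WeakDual ℂ (StrongDual ℂ F)) u)
    ((φ : WeakDual ℂ (StrongDual ℂ F)) v)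
  simp only [map_add, map_sub]
  nlinarith [this]

/-- Points of the ball are functionals on `F*`, so weak nullity is pointwise convergence and the
constant `R ^ 2` dominates. -/
theorem tendsto_sqNorm_zero {w : ℕ → StrongDual ℂ F} {R : ℝ} (hR : ∀ n, ‖w n‖ ≤ R)
    (hw : ∀ φ : StrongDual ℂ (StrongDual ℂ F), Tendsto (fun n => φ (w n)) atTop (𝓝 0)) :
    Tendsto (fun n => sqNorm μ (w n)) atTop (𝓝 0) := by
  have := tendsto_integral_of_dominated_convergence (μ := μ)
    (F := fun n (φ : weakStarBidualBall F) => ‖(φ : WeakDual ℂ (StrongDual ℂ F)) (w n)‖ ^ 2)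
    (f := fun _ => 0) (fun _ => R ^ 2) (fun n => (integrable_sq μ (w n)).aestronglyMeasurable)
    (integrable_const _) (fun n => Eventually.of_forall fun φ => ?_)
    (Eventually.of_forall fun φ => ?_)
  · simpa [sqNorm] using this
  · rw [Real.norm_of_nonneg (by positivity)]
    exact pow_le_pow_left₀ (norm_nonneg _)
      ((norm_apply_le_of_mem_weakStarBidualBall φ _).trans (hR n)) 2
  · simpa using ((hw (WeakDual.toStrongDual φ)).norm.pow 2)

/-- Functionals dominated by an `L^q` norm are small on bounded sets where the `L²` norm is. -/
theorem exists_pos_forall_norm_apply_le {A : Set F} {q C : ℝ} (hq : 1 ≤ q) (hC : 0 ≤ C)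
    (h : ∀ a ∈ A, ∀ y : StrongDual ℂ F, ‖y a‖ ^ q ≤
      C * ∫ φ : weakStarBidualBall F, ‖(φ : WeakDual ℂ (StrongDual ℂ F)) y‖ ^ q ∂μ)
    (R : ℝ) {ε : ℝ} (hε : 0 < ε) :
    ∃ δ, 0 < δ ∧ ∀ y : StrongDual ℂ F, ‖y‖ ≤ R → sqNorm μ y ≤ δ → ∀ a ∈ A, ‖y a‖ ≤ ε := by
  have hq0 : 0 < q := by linarith
  set η := ε ^ q / (2 * (C + 1)) with hη_def
  have hη : 0 < η := by positivity
  set M := (max R 1) ^ q / (η ^ q⁻¹) ^ 2 with hM_def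
  have hR1 : 0 < max R 1 := lt_max_of_lt_right one_pos
  have hM : 0 < M := by positivity
  -- `η` covers `t ≤ η ^ q⁻¹`, and `M` is chosen so that `M * t ^ 2` covers the rest of `[0, R]`.
  -- This compares `L^q` with `L²` whether `q` is below or above `2`; `η` is sized so that `2 * C *
  -- η ≤ ε ^ q`.
  have hpt : ∀ t : ℝ, 0 ≤ t → t ≤ R → t ^ q ≤ η + M * t ^ 2 := by
    intro t ht htR
    rcases le_total t (η ^ q⁻¹) with h1 | h1
    · have : t ^ q ≤ η := by
        rw [← Real.rpow_inv_rpow hη.le hq0.ne']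
        exact Real.rpow_le_rpow ht h1 hq0.le
      nlinarith [mul_nonneg hM.le (sq_nonneg t)]
    · have h2 : t ^ q ≤ (max R 1) ^ q :=
        Real.rpow_le_rpow ht (htR.trans (le_max_left _ _)) hq0.le
      have h3 : 0 < η ^ q⁻¹ := by positivity
      have h4 : (max R 1) ^ q = M * (η ^ q⁻¹) ^ 2 := by
        rw [hM_def, div_mul_cancel₀ _ (by positivity)]
      have h5 : M * (η ^ q⁻¹) ^ 2 ≤ M * t ^ 2 :=
        mul_le_mul_of_nonneg_left (pow_le_pow_left₀ h3.le h1 2) hM.le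
      linarith
  refine ⟨η / M, by positivity, fun y hy hG a ha => ?_⟩
  have hint : ∫ φ : weakStarBidualBall F, ‖(φ : WeakDual ℂ (StrongDual ℂ F)) y‖ ^ q ∂μ ≤
      η + M * sqNorm μ y := by
    have := integral_mono (integrable_weakStarBidualBall_norm_apply_rpow μ hq0.le y)
      ((integrable_const η).add ((integrable_sq μ y).const_mul M)) fun φ =>
        hpt _ (norm_nonneg _) ((norm_apply_le_of_mem_weakStarBidualBall φ y).trans hy)
    refine this.trans_eq ?_
    simp only [Pi.add_apply]
    rw [integral_add (integrable_const η) ((integrable_sq μ y).const_mul M), integral_const_mul]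
    simp [sqNorm]
  have h1 : M * sqNorm μ y ≤ η := by
    rw [mul_comm]
    exact (le_div_iff₀ hM).1 hG
  have h2 : ‖y a‖ ^ q ≤ ε ^ q := by
    calc ‖y a‖ ^ q ≤ C * (2 * η) :=
          (h a ha y).trans (mul_le_mul_of_nonneg_left (by linarith) hC)
      _ ≤ (C + 1) * (2 * η) := by nlinarith
      _ = ε ^ q := by rw [hη_def]; field_simp
  exact (Real.rpow_le_rpow_iff (norm_nonneg _) hε.le hq0).1 h2

end weakStarBidualBall

/-! ### Domination and boundedness of the range -/

/-- Pietsch domination for the range of a Cohen strongly `p`-summing map. -/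
theorem IsCohenStronglySummingHolomorphic.exists_pietsch_measure {p : ℝ≥0∞} (hp : 1 < p)
    {E : Type*} [NormedAddCommGroup E] [NormedSpace ℂ E] {U : Set E} (hU : U.Nonempty)
    {f : E → F} (hf : IsCohenStronglySummingHolomorphic p U f) :
    ∃ C : ℝ, 0 ≤ C ∧ ∃ q : ℝ, 1 ≤ q ∧ ∃ μ : Measure (weakStarBidualBall F),
      IsProbabilityMeasure μ ∧ ∀ a ∈ f '' U, ∀ y : StrongDual ℂ F, ‖y a‖ ^ q ≤
        C * ∫ φ : weakStarBidualBall F, ‖(φ : WeakDual ℂ (StrongDual ℂ F)) y‖ ^ q ∂μ := by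
  obtain ⟨C, hC, q, hq, h⟩ := hf.exists_sum_rpow_le hp
  refine ⟨C, hC, q, hq, _root_.exists_pietsch_measure hq (hU.image f) fun n y a ha => ?_⟩
  choose x hx hxa using ha
  have hcont : Continuous fun φ : weakStarBidualBall F =>
      C * ∑ i, ‖(φ : WeakDual ℂ (StrongDual ℂ F)) (y i)‖ ^ q :=
    continuous_const.mul (continuous_finsetSum _ fun i _ =>
      (continuous_weakStarBidualBall_norm_apply (y i)).rpow_const fun _ => Or.inr (by linarith))
  have hne : Nonempty (weakStarBidualBall F) :=
    ⟨⟨0, mem_weakStarBidualBall.2 (ContinuousLinearMap.opNorm_zero.trans_le zero_le_one)⟩⟩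
  -- Weak* compactness makes the supremum over the ball a maximum, giving the single `φ` that the
  -- separation argument needs.
  obtain ⟨φ, -, hφ⟩ := isCompact_univ.exists_isMaxOn Set.univ_nonempty hcont.continuousOn
  have hmax : ∀ ψ : weakStarBidualBall F,
      C * ∑ i, ‖(ψ : WeakDual ℂ (StrongDual ℂ F)) (y i)‖ ^ q ≤
        C * ∑ i, ‖(φ : WeakDual ℂ (StrongDual ℂ F)) (y i)‖ ^ q := fun ψ => hφ (Set.mem_univ ψ)
  refine ⟨φ, φ.2, ?_⟩
  simp only [← hxa]
  exact h n x y hx _ fun ψ hψ => hmax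
    (⟨StrongDual.toWeakDual ψ, mem_weakStarBidualBall.2 hψ⟩ : weakStarBidualBall F)

/-- The range of a Cohen strongly `p`-summing map is bounded. -/
theorem IsCohenStronglySummingHolomorphic.isBounded_image {p : ℝ≥0∞} (hp : 1 < p)
    {E : Type*} [NormedAddCommGroup E] [NormedSpace ℂ E] {U : Set E}
    {f : E → F} (hf : IsCohenStronglySummingHolomorphic p U f) :
    Bornology.IsBounded (f '' U) := by
  rcases U.eq_empty_or_nonempty with rfl | hU
  · simp
  obtain ⟨C, hC, q, hq, μ, hμ, h⟩ := hf.exists_pietsch_measure hp hU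
  have hq0 : 0 < q := by linarith
  refine isBounded_iff_forall_norm_le.2 ⟨C ^ q⁻¹, fun a ha => ?_⟩
  refine NormedSpace.norm_le_dual_bound ℂ a (by positivity) fun y => ?_
  have h1 := integral_mono (integrable_weakStarBidualBall_norm_apply_rpow μ hq0.le y)
    (integrable_const (‖y‖ ^ q)) fun φ => Real.rpow_le_rpow (norm_nonneg _)
      (norm_apply_le_of_mem_weakStarBidualBall φ y) hq0.le
  simp only [integral_const, probReal_univ, one_smul] at h1
  refine (Real.rpow_le_rpow_iff (norm_nonneg _) (by positivity) hq0).1 ?_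
  rw [Real.mul_rpow (by positivity) (norm_nonneg _), Real.rpow_inv_rpow hC hq0.ne']
  exact (h a ha y).trans (mul_le_mul_of_nonneg_left h1 hC)

end

/-! ### Reflexivity and norm compactness -/

theorem IsReflexiveSpace.strongDual {F : Type*} [NormedAddCommGroup F] [NormedSpace ℂ F]
    (hF : IsReflexiveSpace F) : IsReflexiveSpace (StrongDual ℂ F) := by
  intro Ψ
  refine ⟨Ψ.comp (NormedSpace.inclusionInDoubleDual ℂ F), ?_⟩
  ext Φ
  obtain ⟨x, rfl⟩ := hF Φ
  rfl

/-- Bounded sequences in a reflexive space have weakly convergent subsequences. -/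
theorem IsReflexiveSpace.exists_subseq_tendsto {X : Type*} [NormedAddCommGroup X]
    [NormedSpace ℂ X] (hX : IsReflexiveSpace X) {x : ℕ → X} {R : ℝ} (hx : ∀ n, ‖x n‖ ≤ R) :
    ∃ z : X, ∃ k : ℕ → ℕ, StrictMono k ∧
      ∀ φ : StrongDual ℂ X, Tendsto (fun n => φ (x (k n))) atTop (𝓝 (φ z)) := by
  -- Inside the separable space `Y` countably many functionals separate points, so a subsequence can
  -- be extracted along which all of them converge.
  let Y : Submodule ℂ X := (Submodule.span ℂ (Set.range x)).topologicalClosure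
  have hYsep : TopologicalSpace.IsSeparable (Y : Set X) := by
    rw [Submodule.topologicalClosure_coe]
    exact ((Set.countable_range x).isSeparable.span (R := ℂ)).closure
  obtain ⟨c, hc, hYc⟩ := hYsep
  have : Countable c := hc.to_subtype
  choose g hg1 hg using fun d : c => exists_dual_vector'' ℂ (d : X)
  -- the functionals `g d` separate the points of `Y`
  have hsep : ∀ y ∈ Y, (∀ d, g d y = 0) → y = 0 := by
    intro y hy h0
    by_contra hne
    have hpos : 0 < ‖y‖ := norm_pos_iff.2 hne
    obtain ⟨d, hd, hyd⟩ := Metric.mem_closure_iff.1 (hYc hy) (‖y‖ / 2) (by linarith)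
    rw [dist_eq_norm] at hyd
    have h1 : ‖d‖ ≤ ‖y - d‖ := by
      calc ‖d‖ = ‖g ⟨d, hd⟩ (y - d)‖ := by rw [map_sub, h0, hg]; simp
        _ ≤ 1 * ‖y - d‖ := ContinuousLinearMap.le_of_opNorm_le _ (hg1 _) _
        _ = _ := one_mul _
    have h2 : ‖y‖ ≤ ‖y - d‖ + ‖d‖ := by simpa using norm_add_le (y - d) d
    linarith
  obtain ⟨v, -, k, hk, hv⟩ : ∃ v ∈ Set.pi Set.univ fun _ : c => Metric.closedBall (0 : ℂ) R,
      ∃ k : ℕ → ℕ, StrictMono k ∧ Tendsto ((fun n d => g d (x n)) ∘ k) atTop (𝓝 v) := by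
    refine (isCompact_univ_pi fun _ => isCompact_closedBall _ _).tendsto_subseq fun n d _ => ?_
    rw [mem_closedBall_zero_iff]
    have := ContinuousLinearMap.le_of_opNorm_le _ (hg1 d) (x n)
    linarith [hx n]
  rw [tendsto_pi_nhds] at hv
  have hK : IsCompact (closure (toWeakSpace ℂ X '' Metric.closedBall 0 R)) := by
    refine NormedSpace.isCompact_closure_of_isBounded ℂ X _ ?_ fun Φ _ => ?_
    · rw [Set.preimage_image_eq _ (toWeakSpace ℂ X).injective]
      exact Metric.isBounded_closedBall
    · obtain ⟨z, hz⟩ := hX (WeakDual.toStrongDual Φ)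
      exact ⟨toWeakSpace ℂ X z, congrArg StrongDual.toWeakDual hz⟩
  have hmemK : ∀ n, toWeakSpace ℂ X (x (k n)) ∈
      closure (toWeakSpace ℂ X '' Metric.closedBall 0 R) := fun n =>
    subset_closure ⟨_, mem_closedBall_zero_iff.2 (hx _), rfl⟩
  have hYcl : IsClosed (toWeakSpace ℂ X '' (Y : Set X)) := by
    have h := (Y.restrictScalars ℝ).convex.toWeakSpace_closure ℂ
    simp only [Submodule.coe_restrictScalars] at h
    rw [(Submodule.isClosed_topologicalClosure _).closure_eq] at h
    rw [h]
    exact isClosed_closure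
  have heval : ∀ φ : StrongDual ℂ X, Continuous fun w : WeakSpace ℂ X =>
      φ ((toWeakSpace ℂ X).symm w) := fun φ => WeakBilin.eval_continuous _ φ
  have hcl : ∀ w : WeakSpace ℂ X, MapClusterPt w atTop (fun n => toWeakSpace ℂ X (x (k n))) →
      (toWeakSpace ℂ X).symm w ∈ Y ∧ ∀ d, g d ((toWeakSpace ℂ X).symm w) = v d := by
    intro w hw
    constructor
    · have : w ∈ toWeakSpace ℂ X '' (Y : Set X) := by
        refine hYcl.mem_of_mapClusterPt hw (Eventually.of_forall fun n => ?_)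
        exact ⟨_, Submodule.le_topologicalClosure _ (Submodule.subset_span ⟨_, rfl⟩), rfl⟩
      obtain ⟨y, hy, rfl⟩ := this
      exact hy
    · intro d
      have h1 := hw.tendsto_comp ((heval (g d)).tendsto w)
      have h2 : Tendsto ((fun w : WeakSpace ℂ X => g d ((toWeakSpace ℂ X).symm w)) ∘
          fun n => toWeakSpace ℂ X (x (k n))) atTop (𝓝 (v d)) := hv d
      have : NeBot (𝓝 (g d ((toWeakSpace ℂ X).symm w)) ⊓ 𝓝 (v d)) :=
        ClusterPt.mono h1 h2
      exact eq_of_nhds_neBot this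
  obtain ⟨w, -, hw⟩ := hK.exists_mapClusterPt
    (tendsto_principal.2 (Eventually.of_forall hmemK : ∀ᶠ _ in atTop, _))
  have hlim : Tendsto (fun n => toWeakSpace ℂ X (x (k n))) atTop (𝓝 w) := by
    -- Weak cluster points lie in `Y`, which is weakly closed by convexity, and share the values `v
    -- d`; hence there is only one.
    refine hK.tendsto_nhds_of_unique_mapClusterPt (Eventually.of_forall hmemK) fun w' _ hw' => ?_
    have h1 := hcl w hw
    have h2 := hcl w' hw'
    have := hsep _ (Y.sub_mem h2.1 h1.1) fun d => by rw [map_sub, h1.2, h2.2, sub_self]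
    exact (toWeakSpace ℂ X).symm.injective (sub_eq_zero.1 this)
  exact ⟨(toWeakSpace ℂ X).symm w, k, hk, fun φ => ((heval φ).tendsto w).comp hlim⟩

/-- A set all of whose sequences have convergent subsequences is relatively compact. -/
theorem isRelativelyCompact_of_forall_seq {F : Type*} [NormedAddCommGroup F] {A : Set F}
    (h : ∀ a : ℕ → F, (∀ n, a n ∈ A) → ∃ z, ∃ k : ℕ → ℕ, StrictMono k ∧
      Tendsto (a ∘ k) atTop (𝓝 z)) :
    IsRelativelyCompact A := by
  refine IsSeqCompact.isCompact fun b hb => ?_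
  choose a ha hab using fun n : ℕ => Metric.mem_closure_iff.1 (hb n) (1 / ((n : ℝ) + 1))
    Nat.one_div_pos_of_nat
  obtain ⟨z, k, hk, hz⟩ := h a ha
  have hd : Tendsto (fun n => dist ((a ∘ k) n) ((b ∘ k) n)) atTop (𝓝 0) := by
    refine squeeze_zero (fun _ => dist_nonneg) (fun n => ?_)
      ((tendsto_one_div_add_atTop_nhds_zero_nat (𝕜 := ℝ)).comp hk.tendsto_atTop)
    rw [dist_comm]
    exact (hab (k n)).le
  exact ⟨z, mem_closure_of_tendsto hz (Eventually.of_forall fun n => ha _), k, hk,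
    (tendsto_iff_of_dist hd).1 hz⟩

/-- In a reflexive space, a bounded set on which weakly null sequences of functionals converge
uniformly to zero is relatively compact. -/
theorem IsReflexiveSpace.isRelativelyCompact_of_weaklyNull {F : Type*} [NormedAddCommGroup F]
    [NormedSpace ℂ F] (hF : IsReflexiveSpace F) {A : Set F} (hA : Bornology.IsBounded A)
    (h : ∀ (w : ℕ → StrongDual ℂ F) (R : ℝ), (∀ n, ‖w n‖ ≤ R) →
      (∀ φ : StrongDual ℂ (StrongDual ℂ F), Tendsto (fun n => φ (w n)) atTop (𝓝 0)) →
      ∀ ε > 0, ∀ᶠ n in atTop, ∀ a ∈ A, ‖w n a‖ ≤ ε) :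
    IsRelativelyCompact A := by
  refine isRelativelyCompact_of_forall_seq fun a ha => ?_
  obtain ⟨B, hB⟩ := hA.exists_norm_le
  obtain ⟨z, k, hk, hz⟩ := hF.exists_subseq_tendsto fun n => hB _ (ha n)
  refine ⟨z, k, hk, ?_⟩
  by_contra hnot
  rw [Metric.tendsto_atTop'] at hnot
  push Not at hnot
  obtain ⟨ε, hε, hfar⟩ := hnot
  obtain ⟨j, hj, hjε⟩ := extraction_of_frequently_atTop (P := fun n => ε ≤ dist ((a ∘ k) n) z)
    (frequently_atTop'.2 fun N => (hfar N).imp fun n hn => hn)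
  -- Functionals norming the differences are split as a weakly null part, small on `A` uniformly and
  -- at `z`, plus their weak limit `y₀`, controlled by weak convergence of `a ∘ k`. Three terms
  -- below or at `ε / 4` contradict distance at least `ε`.
  choose y hy1 hy using fun n => exists_dual_vector'' ℂ (a (k (j n)) - z)
  obtain ⟨y₀, m, hm, hlim⟩ := hF.strongDual.exists_subseq_tendsto hy1
  have hnull : ∀ φ : StrongDual ℂ (StrongDual ℂ F),
      Tendsto (fun n => φ (y (m n) - y₀)) atTop (𝓝 0) := by
    intro φ
    simpa using (hlim φ).sub_const (φ y₀)
  have hbd : ∀ n, ‖y (m n) - y₀‖ ≤ 1 + ‖y₀‖ := fun n =>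
    (norm_sub_le _ _).trans (add_le_add_left (hy1 _) _)
  have e1 := h _ _ hbd hnull (ε / 4) (by positivity)
  have e2 : ∀ᶠ n in atTop, ‖(y (m n) - y₀) z‖ < ε / 4 := by
    have := (hnull (NormedSpace.inclusionInDoubleDual ℂ F z)).norm
    rw [norm_zero] at this
    exact this.eventually_lt_const (by positivity)
  have e3 : ∀ᶠ n in atTop, ‖y₀ (a (k (j (m n))) - z)‖ < ε / 4 := by
    have := (((hz y₀).comp (hj.comp hm).tendsto_atTop).sub_const (y₀ z)).norm
    rw [sub_self, norm_zero] at this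
    filter_upwards [this.eventually_lt_const (show 0 < ε / 4 by positivity)] with n hn
    rw [map_sub]
    exact hn
  obtain ⟨n, h1, h2, h3⟩ := (e1.and (e2.and e3)).exists
  have h1' := h1 _ (ha (k (j (m n))))
  have h4 : ε ≤ ‖a (k (j (m n))) - z‖ := by
    rw [← dist_eq_norm]
    exact hjε (m n)
  have h5 : ‖a (k (j (m n))) - z‖ = ‖y (m n) (a (k (j (m n))) - z)‖ := by
    rw [hy]; simp
  have h6 : y (m n) (a (k (j (m n))) - z) = (y (m n) - y₀) (a (k (j (m n)))) -
      (y (m n) - y₀) z + y₀ (a (k (j (m n))) - z) := by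
    simp only [sub_apply, map_sub]; ring
  have h7 : ‖y (m n) (a (k (j (m n))) - z)‖ ≤ ‖(y (m n) - y₀) (a (k (j (m n))))‖ +
      ‖(y (m n) - y₀) z‖ + ‖y₀ (a (k (j (m n))) - z)‖ := by
    rw [h6]
    exact (norm_add_le _ _).trans (add_le_add_left (norm_sub_le _ _) _)
  linarith

end

theorem mainTheorem8 (p : ENNReal) (hp : 1 < p)
    {E F : Type*} [NormedAddCommGroup E] [NormedSpace ℂ E] [CompleteSpace E]
    [NormedAddCommGroup F] [NormedSpace ℂ F] [CompleteSpace F]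
    (U : Set E) (hU : IsOpen U) :
    (∀ f : E → F, IsCohenStronglySummingHolomorphic p U f →
      IsRelativelyWeaklyCompact (f '' U)) ∧
    (IsReflexiveSpace F → ∀ f : E → F, IsCohenStronglySummingHolomorphic p U f →
      IsRelativelyCompact (f '' U)) := by
  rcases U.eq_empty_or_nonempty with rfl | hne
  · simp [IsRelativelyWeaklyCompact, IsRelativelyCompact]
  refine ⟨fun f hf => ?_, fun hF f hf => ?_⟩ <;>
    obtain ⟨C, hC, q, hq, μ, hμ, h⟩ := hf.exists_pietsch_measure hp hne
  · exact isRelativelyWeaklyCompact_of_parallelogram (hf.isBounded_image hp)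
      (weakStarBidualBall.sqNorm μ) (weakStarBidualBall.sqNorm_nonneg μ)
      (weakStarBidualBall.sqNorm_le μ) (weakStarBidualBall.sqNorm_parallelogram μ)
      fun R _ hε => weakStarBidualBall.exists_pos_forall_norm_apply_le μ hq hC h R hε
  · refine hF.isRelativelyCompact_of_weaklyNull (hf.isBounded_image hp) fun w R hR hw ε hε => ?_
    obtain ⟨δ, hδ, hsmall⟩ :=
      weakStarBidualBall.exists_pos_forall_norm_apply_le μ hq hC h R hε
    filter_upwards [(weakStarBidualBall.tendsto_sqNorm_zero μ hR hw).eventually_le_const hδ]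
      with n hn
    exact hsmall (w n) (hR n) hn
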